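/- For a commutative ring $R$ define Motzkin's sets by $A_{R,0}=\{0\}\cup R^\times$ and $A_{R,j}=A_{R,j-1}\cup\{\beta\in R:\text{every coset in }R/\beta R\text{ has a representative in }A_{R,j-1}\}$ for $j\ge 1$. A function $\varphi:R\setminus\{0\}\to\mathbb{N}=\{0,1,2,\dots\}$ is called Euclidean if for every $b\in R\setminus\{0\}$ and every $a\in R$, either $b\mid a$ or there is $r\in R\setminus\{0\}$ with $r\equiv a \pmod b$ and $\varphi(r)<\varphi(b)$. For $n\ge 0$ let $$B_n=\Big\{\sum_{j=0}^n v_j(1+i)^j : v_j\in\{0,\pm1,\pm i\}\Big\}\subset\mathbb{Z}[i],$$ and let $w_{2m}=2^{m+1}+2^m$, $w_{2m+1}=2^{m+2}$ for $m\ge 0$. Write $2^j\parallel(x,y)$ if $2^j$ is the exact power of $2$ dividing $\gcd(x,y)$, where $(x,y)\ne(0,0)$. Theorem. (1) For every $n\ge 0$, $A_{\mathbb{Z}[i],n}=B_n$. (2) Consequently, the function $\varphi_{\mathbb{Z}[i]}$ that sends a nonzero $a+bi$ to the least $n$ with $a+bi\in A_{\mathbb{Z}[i],n}$ is well defined, it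 is a Euclidean function on $\mathbb{Z}[i]$ and the pointwise minimum of all Euclidean functions on $\mathbb{Z}[i]$, and $\varphi_{\mathbb{Z}[i]}(a+bi)$ is the least $n$ with $a+bi\in B_n$. (3) The sets $B_n$, and hence this function, are described explicitly as follows: for every $n\ge 0$, $$B_n\setminus\{0\}=\bigcup_{j=0}^{\lfloor n/2\rfloor}\big\{x+iy : 2^j\parallel(x,y);\ |x|,|y|\le w_n-2^{j+1};\ |x|+|y|\le w_{n+1}-3\cdot2^j\big\}.$$ -/

import Mathlib

/-- `S ↠ R/β`: every coset in `R/β` has a representative in `S`. -/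
def RepresentsAllCosets {R : Type*} [CommRing R] (S : Set R) (β : R) : Prop :=
  ∀ c : R ⧸ Ideal.span {β}, ∃ r ∈ S, Ideal.Quotient.mk (Ideal.span {β}) r = c

/-- Motzkin's sets: `A_{R,0} = {0} ∪ Rˣ` and
`A_{R,j+1} = A_{R,j} ∪ {β : A_{R,j} ↠ R/β}`. -/
def motzkinSet (R : Type*) [CommRing R] : ℕ → Set R
  | 0 => {0} ∪ {a | IsUnit a}
  | j + 1 => motzkinSet R j ∪ {β | RepresentsAllCosets (motzkinSet R j) β}

/-- A function `φ : R \ {0} → ℕ` is Euclidean if for all `b ≠ 0` and all `a`, either `b ∣ a` or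
the coset of `a` modulo `b` contains a nonzero `r` with `φ r < φ b`. -/
def IsEuclideanFunction {R : Type*} [CommRing R] (φ : {a : R // a ≠ 0} → ℕ) : Prop :=
  ∀ (b : {a : R // a ≠ 0}) (a : R), (b : R) ∣ a ∨
    ∃ r : {a : R // a ≠ 0},
      Ideal.Quotient.mk (Ideal.span {(b : R)}) a = Ideal.Quotient.mk (Ideal.span {(b : R)}) r ∧
      φ r < φ b

/-- `φ` is Euclidean and is the pointwise minimum of all Euclidean functions on `R`
(such a `φ` is clearly unique). -/
def IsMinimalEuclideanFunction {R : Type*} [CommRing R] (φ : {a : R // a ≠ 0} → ℕ) : Prop :=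
  IsEuclideanFunction φ ∧
    ∀ f : {a : R // a ≠ 0} → ℕ, IsEuclideanFunction f → ∀ a, φ a ≤ f a

/-- Motzkin's function `φ_R`: the first index `j` with `a ∈ A_{R,j}`. -/
noncomputable def motzkinFunction (R : Type*) [CommRing R] (a : {a : R // a ≠ 0}) : ℕ :=
  sInf {j : ℕ | (a : R) ∈ motzkinSet R j}

/-- The imaginary unit of `ℤ[i]`. -/
def gaussI : GaussianInt := ⟨0, 1⟩

/-- The set `B_n` of all `∑_{j=0}^n v_j (1+i)^j` with digits `v_j ∈ {0, ±1, ±i}`. -/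
def digitSet (n : ℕ) : Set GaussianInt :=
  {z | ∃ v : ℕ → GaussianInt,
    (∀ j, v j ∈ ({0, 1, -1, gaussI, -gaussI} : Set GaussianInt)) ∧
    z = ∑ j ∈ Finset.range (n + 1), v j * (1 + gaussI) ^ j}

/-- The sequence `w_{2m} = 2^{m+1} + 2^m`, `w_{2m+1} = 2^{m+2}`. -/
def wSeq (k : ℕ) : ℤ :=
  if Even k then 2 ^ (k / 2 + 1) + 2 ^ (k / 2) else 2 ^ (k / 2 + 2)

/-- `2^j ∥ (x, y)`: the power `2^j` exactly divides the greatest common divisor of `x` and `y`. -/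
def ExactlyDividesGcd (j : ℕ) (x y : ℤ) : Prop :=
  2 ^ j ∣ Int.gcd x y ∧ ¬ 2 ^ (j + 1) ∣ Int.gcd x y

/-! Both the digit sets and Motzkin's sets are compared with one explicit set, `InDyadicOctagon n`:
the origin and the primitive points of octagon `k` scaled by `2 ^ j`, where `2 * j + k = n`.

Digits: `B_{n+1}` is the set of all `d + (1+i) w` with `d` a digit and `w ∈ B_n`. The octagons obey
the same recursion (`inDyadicOctagon_succ_iff`), because multiplication by `1+i` matches level `n`
with the points of level `n+1` having even coordinate sum, and the remaining points of level `n+1`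
are unit translates of these. Hence `mem_digitSet_iff`.

Motzkin: for `β ≠ 0` it must be shown that `β ∈ B_{n+1}` exactly when `B_n` meets every coset modulo
`β`. A factor `1+i` of `β` can be cancelled while lowering the level, so the substance is `β = p + q
i` with `p + q` odd. If `β` lies in octagon `n+1`, every coset has, up to units, a representative
`a` in the square with diagonal from `0` to `β/(1+i)`, and one of `a`, `a - β`, `a + iβ` lies in
`B_n` (`inDyadicOctagon_of_mem_square`). Conversely, every representative `z` of the coset of a
lattice point next to the centre `β/(1+i)` has `2z + 1 + i` equal to `β` times a number with both
coordinates odd; `z` is then so large that `z ∈ B_n` forces `β` into octagon `n+1`.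

The statements on Euclidean functions then follow from Motzkin's general argument, since the `B_n`
exhaust `ℤ[i]`. -/

/-! ### Octagons, the sequence `w`, and primitive points -/

/-- The octagon `|x|, |y| ≤ w_k - 2`, `|x| + |y| ≤ w_{k+1} - 3`. -/
def InOctagon (k : ℕ) (x y : ℤ) : Prop :=
  |x| ≤ wSeq k - 2 ∧ |y| ≤ wSeq k - 2 ∧ |x| + |y| ≤ wSeq (k + 1) - 3

theorem abs_add_abs_le_iff {x y s : ℤ} :
    |x| + |y| ≤ s ↔ x + y ≤ s ∧ x - y ≤ s ∧ y - x ≤ s ∧ -x - y ≤ s := by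
  rcases abs_cases x with ⟨h, _⟩ | ⟨h, _⟩ <;> rcases abs_cases y with ⟨h', _⟩ | ⟨h', _⟩ <;>
    rw [h, h'] <;> omega

theorem inOctagon_iff {k : ℕ} {x y : ℤ} : InOctagon k x y ↔
    (-(wSeq k - 2) ≤ x ∧ x ≤ wSeq k - 2) ∧ (-(wSeq k - 2) ≤ y ∧ y ≤ wSeq k - 2) ∧
      x + y ≤ wSeq (k + 1) - 3 ∧ x - y ≤ wSeq (k + 1) - 3 ∧ y - x ≤ wSeq (k + 1) - 3 ∧
      -x - y ≤ wSeq (k + 1) - 3 := by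
  rw [InOctagon, abs_le, abs_le, abs_add_abs_le_iff]

/-- The coordinates of the digits `0, ±1, ±i`. -/
def IsDigit (e f : ℤ) : Prop := |e| + |f| ≤ 1

theorem isDigit_iff {e f : ℤ} :
    IsDigit e f ↔ e + f ≤ 1 ∧ e - f ≤ 1 ∧ f - e ≤ 1 ∧ -e - f ≤ 1 := abs_add_abs_le_iff

/-- The union, over `2 * j + k = n`, of the primitive points of the `k`-th octagon scaled by
`2 ^ j`, together with the origin. -/
def InDyadicOctagon (n : ℕ) (x y : ℤ) : Prop :=
  (x = 0 ∧ y = 0) ∨ ∃ (j k : ℕ) (x' y' : ℤ), n = 2 * j + k ∧ x = 2 ^ j * x' ∧ y = 2 ^ j * y' ∧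
    ¬ (2 ∣ x' ∧ 2 ∣ y') ∧ InOctagon k x' y'

theorem wSeq_two_mul (m : ℕ) : wSeq (2 * m) = 3 * 2 ^ m := by
  have : 2 * m / 2 = m := by omega
  simp only [wSeq, even_two_mul, if_true, this]
  ring

theorem wSeq_two_mul_add_one (m : ℕ) : wSeq (2 * m + 1) = 4 * 2 ^ m := by
  have : (2 * m + 1) / 2 = m := by omega
  have h : ¬ Even (2 * m + 1) := by simp
  simp only [wSeq, h, if_false, this]
  ring

theorem wSeq_zero : wSeq 0 = 3 := wSeq_two_mul 0

theorem wSeq_one : wSeq 1 = 4 := wSeq_two_mul_add_one 0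

theorem wSeq_add_two (k : ℕ) : wSeq (k + 2) = 2 * wSeq k := by
  obtain ⟨m, rfl | rfl⟩ := Nat.even_or_odd' k
  · rw [show 2 * m + 2 = 2 * (m + 1) by ring, wSeq_two_mul, wSeq_two_mul]; ring
  · rw [show 2 * m + 1 + 2 = 2 * (m + 1) + 1 by ring, wSeq_two_mul_add_one,
      wSeq_two_mul_add_one]; ring

theorem wSeq_two_mul_add (j k : ℕ) : wSeq (2 * j + k) = 2 ^ j * wSeq k := by
  induction j with
  | zero => simp
  | succ j ih =>
    rw [show 2 * (j + 1) + k = 2 * j + k + 2 by ring, wSeq_add_two, ih]; ring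

/-- Replaces the powers of two by one parameter, so that octagon inequalities become linear for
`omega`; it also records that `w_{k+1}` is even. -/
theorem wSeq_cases (k : ℕ) : ∃ M : ℤ, 1 ≤ M ∧
    ((wSeq k = 3 * M ∧ wSeq (k + 1) = 4 * M) ∨ (wSeq k = 4 * M ∧ wSeq (k + 1) = 6 * M)) := by
  obtain ⟨m, rfl | rfl⟩ := Nat.even_or_odd' k
  · exact ⟨2 ^ m, one_le_pow₀ (by norm_num),
      Or.inl ⟨wSeq_two_mul m, wSeq_two_mul_add_one m⟩⟩
  · refine ⟨2 ^ m, one_le_pow₀ (by norm_num), Or.inr ⟨wSeq_two_mul_add_one m, ?_⟩⟩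
    rw [show 2 * m + 1 + 1 = 2 * (m + 1) by ring, wSeq_two_mul]; ring

theorem exists_eq_two_pow_mul_primitive {x y : ℤ} (h : ¬ (x = 0 ∧ y = 0)) :
    ∃ (j : ℕ) (x' y' : ℤ), x = 2 ^ j * x' ∧ y = 2 ^ j * y' ∧ ¬ (2 ∣ x' ∧ 2 ∣ y') := by
  induction hn : x.natAbs + y.natAbs using Nat.strong_induction_on generalizing x y with
  | _ N ih =>
    by_cases h2 : 2 ∣ x ∧ 2 ∣ y
    · obtain ⟨⟨a, rfl⟩, ⟨b, rfl⟩⟩ := h2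
      obtain ⟨j, x', y', hx, hy, hp⟩ := ih (a.natAbs + b.natAbs) (by omega) (x := a) (y := b)
        (by omega) rfl
      exact ⟨j + 1, x', y', by rw [hx]; ring, by rw [hy]; ring, hp⟩
    · exact ⟨0, x, y, by simp, by simp, h2⟩

theorem two_pow_mul_primitive_unique {i j : ℕ} {x y x' y' : ℤ} (hx : 2 ^ i * x = 2 ^ j * x')
    (hy : 2 ^ i * y = 2 ^ j * y') (hp : ¬ (2 ∣ x ∧ 2 ∣ y)) (hp' : ¬ (2 ∣ x' ∧ 2 ∣ y')) :
    i = j ∧ x = x' ∧ y = y' := by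
  have aux : ∀ {i j : ℕ} {x y x' y' : ℤ}, 2 ^ i * x = 2 ^ j * x' → 2 ^ i * y = 2 ^ j * y' →
      ¬ (2 ∣ x ∧ 2 ∣ y) → j ≤ i := by
    intro i j x y x' y' hx hy hp
    by_contra! hlt
    obtain ⟨d, rfl⟩ := Nat.exists_eq_add_of_lt hlt
    have h0 : (2 : ℤ) ^ i ≠ 0 := by positivity
    refine hp ⟨⟨2 ^ d * x', mul_left_cancel₀ h0 ?_⟩, ⟨2 ^ d * y', mul_left_cancel₀ h0 ?_⟩⟩
    · rw [hx]; ring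
    · rw [hy]; ring
  obtain rfl : i = j := le_antisymm (aux hx.symm hy.symm hp') (aux hx hy hp)
  have h0 : (2 : ℤ) ^ i ≠ 0 := by positivity
  exact ⟨rfl, mul_left_cancel₀ h0 hx, mul_left_cancel₀ h0 hy⟩

theorem inDyadicOctagon_zero (n : ℕ) : InDyadicOctagon n 0 0 := Or.inl ⟨rfl, rfl⟩

theorem inDyadicOctagon_two_pow_mul_iff {n j : ℕ} {x y : ℤ} (hp : ¬ (2 ∣ x ∧ 2 ∣ y)) :
    InDyadicOctagon n (2 ^ j * x) (2 ^ j * y) ↔ ∃ k, n = 2 * j + k ∧ InOctagon k x y := by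
  constructor
  · rintro (⟨hx, hy⟩ | ⟨i, k, x', y', hn, hx, hy, hp', ho⟩)
    · have h0 : (2 : ℤ) ^ j ≠ 0 := by positivity
      simp only [mul_eq_zero, h0, false_or] at hx hy
      exact absurd ⟨by simp [hx], by simp [hy]⟩ hp
    · obtain ⟨rfl, rfl, rfl⟩ := two_pow_mul_primitive_unique hx hy hp hp'
      exact ⟨k, hn, ho⟩
  · rintro ⟨k, hn, ho⟩
    exact Or.inr ⟨j, k, x, y, hn, rfl, rfl, hp, ho⟩

theorem inDyadicOctagon_iff_of_primitive {n : ℕ} {x y : ℤ} (hp : ¬ (2 ∣ x ∧ 2 ∣ y)) :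
    InDyadicOctagon n x y ↔ InOctagon n x y := by
  have := inDyadicOctagon_two_pow_mul_iff (n := n) (j := 0) hp
  simpa using this

theorem InOctagon.mul_I {k : ℕ} {x y : ℤ} (h : InOctagon k x y) : InOctagon k (-y) x := by
  obtain ⟨h1, h2, h3⟩ := h
  exact ⟨by rwa [abs_neg], h1, by rw [abs_neg]; linarith⟩

theorem InOctagon.conj {k : ℕ} {x y : ℤ} (h : InOctagon k x y) : InOctagon k x (-y) := by
  simpa only [InOctagon, abs_neg] using h

theorem InDyadicOctagon.mul_I {n : ℕ} {x y : ℤ} (h : InDyadicOctagon n x y) :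
    InDyadicOctagon n (-y) x := by
  obtain ⟨rfl, rfl⟩ | ⟨j, k, x', y', hn, rfl, rfl, hp, ho⟩ := h
  · exact Or.inl (by simp)
  · exact Or.inr ⟨j, k, -y', x', hn, by ring, rfl, by rwa [dvd_neg, and_comm], ho.mul_I⟩

theorem InDyadicOctagon.conj {n : ℕ} {x y : ℤ} (h : InDyadicOctagon n x y) :
    InDyadicOctagon n x (-y) := by
  obtain ⟨rfl, rfl⟩ | ⟨j, k, x', y', hn, rfl, rfl, hp, ho⟩ := h
  · exact Or.inl (by simp)
  · exact Or.inr ⟨j, k, x', -y', hn, rfl, by ring, by rwa [dvd_neg], ho.conj⟩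

/-! ### The recursion `d + (1+i) w` for octagons -/

/-- Multiplication by `1+i` exchanges the two kinds of sides: `max(|x-y|, |x+y|) = |x| + |y|` and
`|x-y| + |x+y| = 2 max(|x|, |y|)`, while `w_{k+2} = 2 w_k`. The constants `2` and `3` match by
rounding: `2m ≤ 2 w_k - 3` means `m ≤ w_k - 2`, and the odd number `|x| + |y|` is at most the even
number `w_{k+1} - 2` only if it is at most `w_{k+1} - 3`. -/
theorem inOctagon_mul_one_add_I_iff_of_odd {k : ℕ} {x y : ℤ} (h : Odd (x + y)) :
    InOctagon (k + 1) (x - y) (x + y) ↔ InOctagon k x y := by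
  obtain ⟨M, hM, hw⟩ := wSeq_cases k
  obtain ⟨c, hc⟩ := h
  simp only [inOctagon_iff, wSeq_add_two]
  omega

theorem inOctagon_mul_one_sub_I_iff_of_odd {k : ℕ} {x y : ℤ} (h : Odd (x + y)) :
    InOctagon (k + 1) (x + y) (y - x) ↔ InOctagon k x y := by
  obtain ⟨M, hM, hw⟩ := wSeq_cases k
  obtain ⟨c, hc⟩ := h
  simp only [inOctagon_iff, wSeq_add_two]
  omega

/-- Multiplication by `1 + i` carries the `n`-th set onto the even part of the next one. -/
theorem inDyadicOctagon_mul_one_add_I_iff {n : ℕ} {x y : ℤ} :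
    InDyadicOctagon (n + 1) (x - y) (x + y) ↔ InDyadicOctagon n x y := by
  by_cases h0 : x = 0 ∧ y = 0
  · obtain ⟨rfl, rfl⟩ := h0
    simp [inDyadicOctagon_zero]
  obtain ⟨j, x, y, rfl, rfl, hp⟩ := exists_eq_two_pow_mul_primitive h0
  rw [inDyadicOctagon_two_pow_mul_iff hp]
  rcases Int.even_or_odd (x + y) with he | ho
  · obtain ⟨c, hc⟩ := he
    -- Here `x` and `y` are both odd, so `(1+i)(x + iy) = 2(d + ci)` with `d + c` odd and `x + iy =
    -- (1-i)(d + ci)`: the scale `j` rises by one while the octagon index falls by one.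
    obtain ⟨d, hd⟩ : ∃ d, d = x - c := ⟨_, rfl⟩
    have e1 : 2 ^ j * x - 2 ^ j * y = 2 ^ (j + 1) * (d : ℤ) := by
      have : x - y = 2 * d := by omega
      rw [← mul_sub, this]; ring
    have e2 : 2 ^ j * x + 2 ^ j * y = 2 ^ (j + 1) * (c : ℤ) := by
      rw [← mul_add, hc]; ring
    have hx : x = c + d := by omega
    have hy : y = c - d := by omega
    have hcd : Odd (d + c) := by rw [← Int.not_even_iff_odd]; rintro ⟨e, he⟩; omega
    rw [e1, e2, inDyadicOctagon_two_pow_mul_iff (by rw [Int.odd_iff] at hcd; omega)]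
    rw [hx, hy, add_comm c d]
    constructor
    · rintro ⟨k, hn, hk⟩
      exact ⟨k + 1, by omega, (inOctagon_mul_one_sub_I_iff_of_odd hcd).2 hk⟩
    · rintro ⟨k, hn, hk⟩
      -- Octagon `0` contains only the digits, none of which has both coordinates odd.
      rcases k with _ | k
      · rw [Int.odd_iff] at hcd
        simp only [inOctagon_iff, wSeq_zero, zero_add, wSeq_one] at hk
        omega
      · exact ⟨k, by omega, (inOctagon_mul_one_sub_I_iff_of_odd hcd).1 hk⟩
  · rw [← mul_sub, ← mul_add, inDyadicOctagon_two_pow_mul_iff (by rw [Int.odd_iff] at ho; omega)]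
    constructor
    · rintro ⟨k, hn, hk⟩
      rcases k with _ | k
      · rw [Int.odd_iff] at ho
        simp only [inOctagon_iff, wSeq_zero, zero_add, wSeq_one] at hk
        omega
      · exact ⟨k, by omega, (inOctagon_mul_one_add_I_iff_of_odd ho).1 hk⟩
    · rintro ⟨k, hn, hk⟩
      exact ⟨k + 1, by omega, (inOctagon_mul_one_add_I_iff_of_odd ho).2 hk⟩

/-- There is room for one unit step. For `j = 0` both coordinates are odd, and parity sharpens each
bound by one; for larger `j` the bounds are already `w_{n+1} - 2^{j+1}` and `w_{n+2} - 3 * 2^j`. -/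
theorem InDyadicOctagon.inOctagon_add_unit {n : ℕ} {x y e f : ℤ} (he : Even (x + y))
    (h : InDyadicOctagon (n + 1) x y) (hd : IsDigit e f) :
    InOctagon (n + 1) (x + e) (y + f) := by
  obtain ⟨M, hM, hw⟩ := wSeq_cases n
  obtain ⟨c, hc⟩ := he
  rw [isDigit_iff] at hd
  obtain ⟨rfl, rfl⟩ | ⟨j, k, x', y', hn, rfl, rfl, hp, ho⟩ := h
  · simp only [inOctagon_iff, wSeq_add_two]
    omega
  · rcases j with _ | j
    · obtain rfl : n + 1 = k := by omega
      simp only [inOctagon_iff, wSeq_add_two, pow_zero, one_mul] at ho hc ⊢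
      omega
    · have h1 : (1 : ℤ) ≤ 2 ^ j := one_le_pow₀ (by norm_num)
      obtain ⟨h2, h3, h4⟩ := ho
      have e1 : wSeq (n + 1) = 2 ^ (j + 1) * wSeq k := by rw [hn, wSeq_two_mul_add]
      have e2 : wSeq (n + 1 + 1) = 2 ^ (j + 1) * wSeq (k + 1) := by
        rw [hn, ← wSeq_two_mul_add]; rfl
      have hpos : (0 : ℤ) ≤ 2 ^ (j + 1) := by positivity
      have a1 := mul_le_mul_of_nonneg_left h2 hpos
      have a2 := mul_le_mul_of_nonneg_left h3 hpos
      have a3 := mul_le_mul_of_nonneg_left h4 hpos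
      rw [mul_sub, ← e1] at a1 a2
      rw [mul_sub, ← e2, mul_add] at a3
      have b1 : |2 ^ (j + 1) * x'| = 2 ^ (j + 1) * |x'| := by rw [abs_mul, abs_of_nonneg hpos]
      have b2 : |2 ^ (j + 1) * y'| = 2 ^ (j + 1) * |y'| := by rw [abs_mul, abs_of_nonneg hpos]
      rw [← b1] at a1 a3
      rw [← b2] at a2 a3
      have h5 : (2 : ℤ) ^ (j + 1) = 2 * 2 ^ j := by ring
      rw [abs_le] at a1 a2
      rw [abs_add_abs_le_iff] at a3
      rw [inOctagon_iff]
      omega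

theorem InOctagon.exists_unit {n : ℕ} {x y : ℤ} (ho : Odd (x + y)) (h : InOctagon (n + 1) x y) :
    ∃ e f, IsDigit e f ∧ Even (x - e + (y - f)) ∧ InDyadicOctagon (n + 1) (x - e) (y - f) := by
  obtain ⟨M, hM, hw⟩ := wSeq_cases n
  -- Move the even coordinate by one, towards zero unless it is zero. Both coordinates are then odd,
  -- so the new point is primitive and only the octagon has to be checked.
  have key : ∃ e f, IsDigit e f ∧ (x - e) % 2 = 1 ∧ (y - f) % 2 = 1 ∧
      InOctagon (n + 1) (x - e) (y - f) := by
    rw [Int.odd_iff] at ho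
    simp only [inOctagon_iff, wSeq_add_two, isDigit_iff] at h ⊢
    by_cases hx : x % 2 = 0
    · by_cases hx0 : 0 < x
      · exact ⟨1, 0, by omega⟩
      · exact ⟨-1, 0, by omega⟩
    · by_cases hy0 : 0 < y
      · exact ⟨0, 1, by omega⟩
      · exact ⟨0, -1, by omega⟩
  obtain ⟨e, f, hd, hx, hy, hO⟩ := key
  exact ⟨e, f, hd, by rw [Int.even_iff]; omega,
    (inDyadicOctagon_iff_of_primitive (by omega)).2 hO⟩

theorem inDyadicOctagon_succ_iff {n : ℕ} {x y : ℤ} :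
    InDyadicOctagon (n + 1) x y ↔ ∃ e f u v, IsDigit e f ∧ InDyadicOctagon n u v ∧
      x = e + (u - v) ∧ y = f + (u + v) := by
  constructor
  · intro h
    have : ∃ e f, IsDigit e f ∧ Even (x - e + (y - f)) ∧
        InDyadicOctagon (n + 1) (x - e) (y - f) := by
      rcases Int.even_or_odd (x + y) with he | ho
      · exact ⟨0, 0, by simp [IsDigit], by simpa using he, by simpa using h⟩
      · refine InOctagon.exists_unit ho ((inDyadicOctagon_iff_of_primitive ?_).1 h)
        rw [Int.odd_iff] at ho; omega
    obtain ⟨e, f, hd, ⟨u, hu⟩, h⟩ := this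
    refine ⟨e, f, u, u - (x - e), hd, ?_, by ring, by linarith⟩
    rw [← inDyadicOctagon_mul_one_add_I_iff]
    convert h using 1 <;> linarith
  · rintro ⟨e, f, u, v, hd, h, rfl, rfl⟩
    rw [← inDyadicOctagon_mul_one_add_I_iff] at h
    rcases Int.even_or_odd (e + f) with he | ho
    · have : e = 0 ∧ f = 0 := by
        rw [Int.even_iff] at he; rw [isDigit_iff] at hd; omega
      simpa [this.1, this.2] using h
    · rw [add_comm e, add_comm f]
      rw [inDyadicOctagon_iff_of_primitive (by rw [Int.odd_iff] at ho; omega)]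
      exact h.inOctagon_add_unit ⟨u, by ring⟩ hd

theorem inDyadicOctagon_zero_iff {x y : ℤ} : InDyadicOctagon 0 x y ↔ IsDigit x y := by
  constructor
  · rintro (⟨rfl, rfl⟩ | ⟨j, k, x', y', hn, rfl, rfl, hp, ho⟩)
    · simp [IsDigit]
    · obtain ⟨rfl, rfl⟩ : j = 0 ∧ k = 0 := by omega
      have := ho.2.2
      rw [zero_add, wSeq_one] at this
      simpa [IsDigit] using this
  · intro h
    by_cases h0 : x = 0 ∧ y = 0
    · exact Or.inl h0
    · rw [isDigit_iff] at h
      rw [inDyadicOctagon_iff_of_primitive (by omega)]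
      simp only [inOctagon_iff, wSeq_zero, zero_add, wSeq_one]
      omega

theorem InDyadicOctagon.succ {n : ℕ} {x y : ℤ} (h : InDyadicOctagon n x y) :
    InDyadicOctagon (n + 1) x y := by
  induction n generalizing x y with
  | zero =>
    exact inDyadicOctagon_succ_iff.2
      ⟨x, y, 0, 0, inDyadicOctagon_zero_iff.1 h, inDyadicOctagon_zero 0, by simp, by simp⟩
  | succ n ih =>
    obtain ⟨e, f, u, v, hd, h, hx, hy⟩ := inDyadicOctagon_succ_iff.1 h
    exact inDyadicOctagon_succ_iff.2 ⟨e, f, u, v, hd, ih h, hx, hy⟩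

/-! ### Odd `β` in the octagon: every coset is represented -/

/-- `K` is the power of two in `gcd(x, y)`, capped so as to divide `w_n` and `w_{n+1}`. As
everything is a multiple of `K`, exceeding the bounds `w_n - 2K` or `w_{n+1} - 3K` means
overshooting by a full `K`. -/
theorem exists_scale_of_not_inDyadicOctagon {n : ℕ} {x y : ℤ} (h0 : ¬ (x = 0 ∧ y = 0))
    (h : ¬ InDyadicOctagon n x y) : ∃ K : ℤ, 0 < K ∧ K ∣ x ∧ K ∣ y ∧ K ∣ wSeq n ∧
      K ∣ wSeq (n + 1) ∧ K ≤ wSeq (n + 1) - wSeq n ∧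
      (wSeq n - K ≤ |x| ∨ wSeq n - K ≤ |y| ∨ wSeq (n + 1) - 2 * K ≤ |x| + |y|) := by
  obtain ⟨j, x, y, rfl, rfl, hp⟩ := exists_eq_two_pow_mul_primitive h0
  rcases le_or_gt (2 * j) n with hjn | hjn
  · obtain ⟨k, rfl⟩ := Nat.exists_eq_add_of_le hjn
    have hK : (0 : ℤ) < 2 ^ j := by positivity
    have hO : ¬ InOctagon k x y := fun hO => h ((inDyadicOctagon_two_pow_mul_iff hp).2 ⟨k, rfl, hO⟩)
    obtain ⟨M, hM, hw⟩ := wSeq_cases k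
    refine ⟨2 ^ j, hK, dvd_mul_right _ _, dvd_mul_right _ _, ?_⟩
    rw [add_assoc, wSeq_two_mul_add, wSeq_two_mul_add, abs_mul, abs_mul, abs_of_pos hK]
    refine ⟨dvd_mul_right _ _, dvd_mul_right _ _, ?_, ?_⟩
    · have : 1 ≤ wSeq (k + 1) - wSeq k := by omega
      nlinarith
    · have h3 : wSeq k - 1 ≤ |x| ∨ wSeq k - 1 ≤ |y| ∨ wSeq (k + 1) - 2 ≤ |x| + |y| := by
        unfold InOctagon at hO
        by_contra! h3
        exact hO (by omega)
      rcases h3 with h3 | h3 | h3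
      · exact Or.inl (by nlinarith)
      · exact Or.inr (Or.inl (by nlinarith))
      · exact Or.inr (Or.inr (by nlinarith))
  · have large : ∀ K : ℤ, 0 < K → K ∣ 2 ^ j → K ≤ |2 ^ j * x| ∨ K ≤ |2 ^ j * y| := by
      intro K hK hd
      by_cases hx : x = 0
      · have hy : 2 ^ j * y ≠ 0 := by
          simp only [ne_eq, mul_eq_zero, pow_eq_zero_iff', OfNat.ofNat_ne_zero, false_and,
            false_or]
          rintro rfl
          exact hp (by simp [hx])
        exact Or.inr (Int.le_of_dvd (abs_pos.2 hy) ((dvd_abs _ _).2 (hd.mul_right _)))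
      · have hx : 2 ^ j * x ≠ 0 := by simp [hx]
        exact Or.inl (Int.le_of_dvd (abs_pos.2 hx) ((dvd_abs _ _).2 (hd.mul_right _)))
    obtain ⟨m, rfl | rfl⟩ := Nat.even_or_odd' n
    · have hd : (2 : ℤ) ^ (m + 1) ∣ 2 ^ j := pow_dvd_pow _ (by omega)
      have hd' : (2 : ℤ) ^ m ∣ 2 ^ j := pow_dvd_pow _ (by omega)
      have hl := large (2 ^ (m + 1)) (by positivity) hd
      rw [pow_succ] at hl
      refine ⟨2 ^ m, by positivity, hd'.mul_right _, hd'.mul_right _, ?_⟩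
      rw [wSeq_two_mul, wSeq_two_mul_add_one]
      exact ⟨dvd_mul_left _ _, dvd_mul_left _ _, by omega, by omega⟩
    · have hd : (2 : ℤ) ^ (m + 1) ∣ 2 ^ j := pow_dvd_pow _ (by omega)
      have hl := large (2 ^ (m + 1)) (by positivity) hd
      refine ⟨2 ^ (m + 1), by positivity, hd.mul_right _, hd.mul_right _, ?_⟩
      rw [wSeq_add_two, wSeq_two_mul, wSeq_two_mul_add_one]
      rw [pow_succ] at hl ⊢
      exact ⟨⟨2, by ring⟩, ⟨3, by ring⟩, by omega, by omega⟩

theorem Int.add_le_of_dvd_of_lt {K u v : ℤ} (hu : K ∣ u) (hv : K ∣ v) (h : u < v) : u + K ≤ v := by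
  have := Int.le_of_dvd (sub_pos.2 h) (dvd_sub hv hu)
  omega

/-- If `x + y i` lies in the square with diagonal from `0` to `β / (1 + i)`, where `β = p + q i` is
odd with `0 ≤ p < q`, then one of `a`, `a - β`, `a + i β` lies in the `n`-th set. -/
theorem inDyadicOctagon_of_mem_square {n : ℕ} {p q x y : ℤ} (hp : 0 ≤ p) (hpq : p < q)
    (hodd : Odd (p + q)) (hO : InOctagon (n + 1) p q)
    (hA : 0 ≤ 2 * (x * p + y * q)) (hA' : 2 * (x * p + y * q) ≤ p * p + q * q)
    (hB : 0 ≤ 2 * (x * q - y * p)) (hB' : 2 * (x * q - y * p) ≤ p * p + q * q) :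
    InDyadicOctagon n x y ∨ InDyadicOctagon n (x - p) (y - q) ∨
      InDyadicOctagon n (x - q) (y + p) := by
  obtain ⟨N, hN⟩ : ∃ N, N = p * p + q * q := ⟨_, rfl⟩
  obtain ⟨A, hAd⟩ : ∃ A, A = 2 * (x * p + y * q) := ⟨_, rfl⟩
  obtain ⟨B, hBd⟩ : ∃ B, B = 2 * (x * q - y * p) := ⟨_, rfl⟩
  rw [← hAd] at hA hA'
  rw [← hBd] at hB hB'
  rw [← hN] at hA' hB'
  have hN0 : 0 < N := by rw [hN]; nlinarith
  have ex : 2 * x * N = A * p + B * q := by rw [hN, hAd, hBd]; ring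
  have ey : 2 * y * N = A * q - B * p := by rw [hN, hAd, hBd]; ring
  by_cases h0 : x = 0 ∧ y = 0
  · obtain ⟨rfl, rfl⟩ := h0
    exact Or.inl (inDyadicOctagon_zero n)
  rw [Int.odd_iff] at hodd
  have f1 : 0 ≤ x := by
    have : 0 ≤ 2 * x * N := by rw [ex]; nlinarith
    nlinarith
  have f2 : 2 * x ≤ p + q := by
    refine le_of_mul_le_mul_right ?_ hN0
    nlinarith
  have f3 : 2 * y ≤ q := by
    refine le_of_mul_le_mul_right ?_ hN0
    nlinarith
  have f4 : 2 * (x - y) ≤ p + q := by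
    refine le_of_mul_le_mul_right ?_ hN0
    nlinarith
  have f5 : x + y ≤ q := by
    refine le_of_mul_le_mul_right ?_ (mul_pos two_pos hN0)
    nlinarith
  have f6 : 0 ≤ x + y := by
    have : 0 ≤ 2 * (x + y) * N := by nlinarith
    nlinarith
  -- On the square, `x + y = q` only at the corner `β/(1+i)`, which is not a lattice point because
  -- `p + q` is odd.
  have f7 : x + y ≠ q := by
    intro h
    have e : (N - A) * (p + q) + (N - B) * (q - p) = 0 := by
      have : 2 * (x + y) * N = 2 * q * N := by rw [h]
      linarith
    have hA1 : A = N := by nlinarith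
    have hB1 : B = N := by nlinarith
    have : 2 * x * N = (p + q) * N := by rw [ex, hA1, hB1]; ring
    have := mul_right_cancel₀ hN0.ne' this
    omega
  have f8 : x + y ≠ 0 := by
    intro h
    have e : A * (p + q) + B * (q - p) = 0 := by
      have : 2 * (x + y) * N = 0 := by rw [h]; ring
      linarith
    have hA1 : A = 0 := by nlinarith
    have hB1 : B = 0 := by nlinarith
    rw [hA1, hB1] at ex
    have : x * N = 0 := by linarith
    have : x = 0 := by simpa [hN0.ne'] using this
    omega
  obtain ⟨M, hM, hw⟩ := wSeq_cases n
  rw [inOctagon_iff, wSeq_add_two] at hO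
  have hOa : InOctagon n x y := by
    rw [inOctagon_iff]
    omega
  by_cases hprim : ¬ (2 ∣ x ∧ 2 ∣ y)
  · exact Or.inl ((inDyadicOctagon_iff_of_primitive hprim).2 hOa)
  by_cases hS : InDyadicOctagon n x y
  · exact Or.inl hS
  obtain ⟨K, hK, hKx, hKy, hKW, hKW', hKc, hex⟩ := exists_scale_of_not_inDyadicOctagon h0 hS
  rw [abs_of_nonneg f1] at hex
  have g1 : y < 0 → y + K ≤ 0 := Int.add_le_of_dvd_of_lt hKy (dvd_zero _)
  have g2 := Int.add_le_of_dvd_of_lt hKy (dvd_sub hKW' hKW)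
  have g3 := Int.add_le_of_dvd_of_lt (dvd_sub hKx hKy) hKW
  have g4 := Int.add_le_of_dvd_of_lt hKx (dvd_sub hKW' hKW)
  have g5 := Int.add_le_of_dvd_of_lt hKx hKW
  -- Now `x` and `y` are even while `p + q` is odd, so both translates have odd coordinate sum and
  -- are primitive.
  rw [inDyadicOctagon_iff_of_primitive (n := n) (x := x - p) (by omega),
    inDyadicOctagon_iff_of_primitive (n := n) (x := x - q) (by omega)]
  right
  rw [inOctagon_iff, inOctagon_iff]
  generalize wSeq n = W at *
  generalize wSeq (n + 1) = W' at *
  clear ex ey hA hA' hB hB' hAd hBd hN hN0 hKx hKy hKW hKW' hS h0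
  rcases lt_or_ge y 0 with hy | hy
  · rw [abs_of_neg hy] at hex
    exfalso
    omega
  · rw [abs_of_nonneg hy] at hex
    have hWK : W' - W ≤ W - K := by omega
    -- Below this threshold `y ≤ W' - W - K`, and `hex` leaves only `x ≥ W - K`.
    by_cases hc : W' - W ≤ y
    · by_cases hxy : x - y ≤ p
      · left
        omega
      · right
        omega
    · by_cases hxy : p ≤ x - y
      · right
        omega
      · by_cases hqy : q - y ≤ W - 2
        · left
          omega
        · right
          omega

/-- Some element of the coset of `x + y i` modulo `p + q i` lies in the `n`-th set. -/
def HasDyadicRepresentative (n : ℕ) (p q x y : ℤ) : Prop :=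
  ∃ s t : ℤ, InDyadicOctagon n (x - (p * s - q * t)) (y - (p * t + q * s))

theorem HasDyadicRepresentative.of_mul_I {n : ℕ} {p q x y : ℤ}
    (h : HasDyadicRepresentative n p q (-y) x) : HasDyadicRepresentative n p q x y := by
  obtain ⟨s, t, h⟩ := h
  refine ⟨t, -s, ?_⟩
  convert h.mul_I.mul_I.mul_I using 1 <;> ring

theorem HasDyadicRepresentative.of_sub {n : ℕ} {p q x y : ℤ} (s t : ℤ)
    (h : HasDyadicRepresentative n p q (x - (p * s - q * t)) (y - (p * t + q * s))) :
    HasDyadicRepresentative n p q x y := by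
  obtain ⟨s', t', h⟩ := h
  refine ⟨s + s', t + t', ?_⟩
  convert h using 1 <;> ring

theorem exists_centered_remainder (X : ℤ) {N : ℤ} (hN : 0 < N) :
    ∃ s, -N ≤ 2 * (X - s * N) ∧ 2 * (X - s * N) ≤ N := by
  refine ⟨(2 * X + N) / (2 * N), ?_⟩
  have h1 := Int.emod_add_mul_ediv (2 * X + N) (2 * N)
  have h2 := Int.emod_nonneg (2 * X + N) (by omega : 2 * N ≠ 0)
  have h3 := Int.emod_lt_of_pos (2 * X + N) (by omega : 0 < 2 * N)
  constructor <;> nlinarith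

theorem hasDyadicRepresentative_of_nonneg_of_lt {n : ℕ} {p q : ℤ} (hp : 0 ≤ p) (hpq : p < q)
    (hodd : Odd (p + q)) (hO : InOctagon (n + 1) p q) (x y : ℤ) :
    HasDyadicRepresentative n p q x y := by
  have corner : ∀ x y : ℤ, 0 ≤ 2 * (x * p + y * q) → 2 * (x * p + y * q) ≤ p * p + q * q →
      0 ≤ 2 * (x * q - y * p) → 2 * (x * q - y * p) ≤ p * p + q * q →
      HasDyadicRepresentative n p q x y := by
    intro x y hA hA' hB hB'
    rcases inDyadicOctagon_of_mem_square hp hpq hodd hO hA hA' hB hB' with h | h | h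
    · exact ⟨0, 0, by simpa using h⟩
    · exact ⟨1, 0, by simpa using h⟩
    · exact ⟨0, -1, by convert h using 1 <;> ring⟩
  have hN : 0 < p * p + q * q := by nlinarith
  -- The two arguments are the real and imaginary parts of `a` times the conjugate of `β`, where `a
  -- = x + iy`. After subtracting `β(s + ti)`, both coordinates of `a/β` lie in `[-1/2, 1/2]`; a
  -- power of `i` then rotates `a/β` into the quadrant that `corner` handles.
  obtain ⟨s, hs, hs'⟩ := exists_centered_remainder (x * p + y * q) hN
  obtain ⟨t, ht, ht'⟩ := exists_centered_remainder (y * p - x * q) hN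
  apply HasDyadicRepresentative.of_sub s t
  have e1 : (x - (p * s - q * t)) * p + (y - (p * t + q * s)) * q =
    x * p + y * q - s * (p * p + q * q) := by ring
  have e2 : (y - (p * t + q * s)) * p - (x - (p * s - q * t)) * q =
    y * p - x * q - t * (p * p + q * q) := by ring
  rw [← e1] at hs hs'
  rw [← e2] at ht ht'
  generalize x - (p * s - q * t) = u at *
  generalize y - (p * t + q * s) = v at *
  rcases le_total 0 (u * p + v * q) with hX | hX <;> rcases le_total 0 (v * p - u * q) with hY | hY
  · apply HasDyadicRepresentative.of_mul_I
    apply HasDyadicRepresentative.of_mul_I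
    apply HasDyadicRepresentative.of_mul_I
    apply corner <;> linarith
  · apply corner <;> linarith
  · apply HasDyadicRepresentative.of_mul_I
    apply HasDyadicRepresentative.of_mul_I
    apply corner <;> linarith
  · apply HasDyadicRepresentative.of_mul_I
    apply corner <;> linarith

theorem forall_hasDyadicRepresentative_neg_right {n : ℕ} {p q : ℤ}
    (h : ∀ x y, HasDyadicRepresentative n p q x y) (x y : ℤ) :
    HasDyadicRepresentative n p (-q) x y := by
  obtain ⟨s, t, h⟩ := h x (-y)
  refine ⟨s, -t, ?_⟩
  convert h.conj using 1 <;> ring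

theorem forall_hasDyadicRepresentative_swap {n : ℕ} {p q : ℤ}
    (h : ∀ x y, HasDyadicRepresentative n p q x y) (x y : ℤ) :
    HasDyadicRepresentative n q p x y := by
  obtain ⟨s, t, h⟩ := h y x
  refine ⟨s, -t, ?_⟩
  convert h.conj.mul_I using 1 <;> ring

theorem forall_hasDyadicRepresentative_neg_left {n : ℕ} {p q : ℤ}
    (h : ∀ x y, HasDyadicRepresentative n p q x y) (x y : ℤ) :
    HasDyadicRepresentative n (-p) q x y :=
  forall_hasDyadicRepresentative_swap (forall_hasDyadicRepresentative_neg_right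
    (forall_hasDyadicRepresentative_swap h)) x y

theorem hasDyadicRepresentative_of_odd {n : ℕ} {p q : ℤ}
    (hodd : Odd (p + q)) (hO : InOctagon (n + 1) p q) :
    ∀ x y : ℤ, HasDyadicRepresentative n p q x y := by
  have pos : ∀ p q : ℤ, 0 ≤ p → 0 ≤ q → Odd (p + q) → InOctagon (n + 1) p q →
      ∀ x y : ℤ, HasDyadicRepresentative n p q x y := by
    intro p q hp hq hodd hO
    rcases lt_trichotomy p q with h | rfl | h
    · exact hasDyadicRepresentative_of_nonneg_of_lt hp h hodd hO
    · exact absurd hodd (by rw [← two_mul]; simp)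
    · exact forall_hasDyadicRepresentative_swap (hasDyadicRepresentative_of_nonneg_of_lt hq h
        (by rwa [add_comm]) (by simpa using hO.mul_I.conj.mul_I.mul_I))
  have habs : ∀ x y : ℤ, HasDyadicRepresentative n |p| |q| x y := by
    refine pos |p| |q| (abs_nonneg p) (abs_nonneg q) ?_ (by simpa [InOctagon] using hO)
    rcases abs_choice p with h | h <;> rcases abs_choice q with h' | h' <;> rw [h, h'] <;>
      rw [Int.odd_iff] at hodd ⊢ <;> omega
  have hq : ∀ x y : ℤ, HasDyadicRepresentative n |p| q x y := by
    rcases abs_choice q with h | h <;> rw [h] at habs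
    · exact habs
    · simpa using forall_hasDyadicRepresentative_neg_right habs
  rcases abs_choice p with h | h <;> rw [h] at hq
  · exact hq
  · simpa using forall_hasDyadicRepresentative_neg_left hq

/-! ### Odd `β` with every coset represented: the octagon is forced -/

/-- The products `(pA)(qB)` and `(qA)(-pB)` have opposite signs, so in one of the two sums there is
no cancellation, and `|A|, |B| ≥ 1`. -/
theorem le_max_abs_of_odd {p q A B : ℤ} (hA : Odd A) (hB : Odd B) :
    |p| + |q| ≤ |p * A + q * B| ∨ |p| + |q| ≤ |q * A - p * B| := by
  have hA1 : 1 ≤ |A| := Int.one_le_abs (by rintro rfl; simp at hA)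
  have hB1 : 1 ≤ |B| := Int.one_le_abs (by rintro rfl; simp at hB)
  have hp := abs_nonneg p
  have hq := abs_nonneg q
  rcases le_total 0 ((p * A) * (q * B)) with h | h
  · left
    rw [abs_add_eq_add_abs_iff _ _ |>.2 (mul_nonneg_iff.1 h), abs_mul, abs_mul]
    nlinarith
  · right
    have h : 0 ≤ (q * A) * (-(p * B)) := by linarith
    rw [sub_eq_add_neg, abs_add_eq_add_abs_iff _ _ |>.2 (mul_nonneg_iff.1 h), abs_neg, abs_mul,
      abs_mul]
    nlinarith

theorem two_mul_max_abs_le_of_odd {p q A B : ℤ} (hA : Odd A) (hB : Odd B) :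
    2 * |p| ≤ |p * A + q * B| + |q * A - p * B| ∧
      2 * |q| ≤ |p * A + q * B| + |q * A - p * B| := by
  have hA1 : 1 ≤ |A| := Int.one_le_abs (by rintro rfl; simp at hA)
  have hB1 : 1 ≤ |B| := Int.one_le_abs (by rintro rfl; simp at hB)
  have hp := abs_nonneg p
  have hq := abs_nonneg q
  have key : ∀ P Q a b u v : ℤ, 0 ≤ P → 0 ≤ Q → 1 ≤ a → 1 ≤ b → u = P * a + Q * b →
      |Q * a - P * b| ≤ v → 2 * P ≤ u + v ∧ 2 * Q ≤ u + v := by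
    intro P Q a b u v hP hQ ha hb hu hv
    rw [abs_le] at hv
    have h1 : 2 * P ≤ u + v ∨ P < Q := by
      rcases le_or_gt Q P with h | h
      · left
        rcases le_total b a with h' | h' <;> nlinarith
      · exact Or.inr h
    have h2 : 2 * Q ≤ u + v ∨ Q < P := by
      rcases le_or_gt P Q with h | h
      · left
        rcases le_total b a with h' | h' <;> nlinarith
      · exact Or.inr h
    omega
  have e1 := abs_abs_sub_abs_le_abs_sub (q * A) (p * B)
  have e2 := abs_abs_sub_abs_le_abs_sub (p * A) (-(q * B))
  rw [sub_neg_eq_add, abs_neg] at e2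
  simp only [abs_mul] at e1 e2
  rcases le_total 0 ((p * A) * (q * B)) with h | h
  · refine key |p| |q| |A| |B| _ _ hp hq hA1 hB1 ?_ e1
    rw [abs_add_eq_add_abs_iff _ _ |>.2 (mul_nonneg_iff.1 h), abs_mul, abs_mul]
  · have h : 0 ≤ (q * A) * (-(p * B)) := by linarith
    have := key |q| |p| |A| |B| |q * A - p * B| _ hq hp hA1 hB1 (by
      rw [sub_eq_add_neg, abs_add_eq_add_abs_iff _ _ |>.2 (mul_nonneg_iff.1 h), abs_neg, abs_mul,
        abs_mul]) e2
    rw [add_comm |p * A + q * B|]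
    exact this.symm

theorem InDyadicOctagon.inOctagon_or {n : ℕ} {x y : ℤ} (h : InDyadicOctagon n x y) :
    (x = 0 ∧ y = 0) ∨ InOctagon n x y := by
  obtain h | ⟨j, k, x, y, rfl, rfl, rfl, hp, h1, h2, h3⟩ := h
  · exact Or.inl h
  · right
    have hj : (1 : ℤ) ≤ 2 ^ j := one_le_pow₀ (by norm_num)
    rw [InOctagon, add_assoc, wSeq_two_mul_add, wSeq_two_mul_add, abs_mul, abs_mul,
      abs_of_pos (by positivity : (0 : ℤ) < 2 ^ j)]
    exact ⟨by nlinarith, by nlinarith, by nlinarith⟩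

/-- If every coset modulo an odd `β = p + q i` meets the `n`-th set, so does the coset of a lattice
point closest to `β / (1 + i)`, and this forces `β` into the next octagon. -/
theorem inOctagon_of_forall_hasDyadicRepresentative {n : ℕ} {p q : ℤ} (hodd : Odd (p + q))
    (h : ∀ x y, HasDyadicRepresentative n p q x y) : InOctagon (n + 1) p q := by
  obtain ⟨c, hc⟩ := hodd
  obtain ⟨s, t, h⟩ := h c (c - p)
  obtain ⟨x, hx⟩ : ∃ x, x = c - (p * s - q * t) := ⟨_, rfl⟩
  obtain ⟨y, hy⟩ : ∃ y, y = c - p - (p * t + q * s) := ⟨_, rfl⟩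
  rw [← hx, ← hy] at h
  have hA : Odd (1 - 2 * s) := ⟨-s, by ring⟩
  have hB : Odd (1 + 2 * t) := ⟨t, by ring⟩
  -- With `a = c + (c - p) i` one has `2a + 1 + i = β(1 - i)`; subtracting `2β(s + ti)` leaves `β((1
  -- - 2s) - (1 + 2t) i)`, whose cofactor has odd coordinates.
  have eu : 2 * x + 1 = p * (1 - 2 * s) + q * (1 + 2 * t) := by rw [hx]; linarith
  have ev : 2 * y + 1 = q * (1 - 2 * s) - p * (1 + 2 * t) := by rw [hy]; linarith
  have h1 := le_max_abs_of_odd (p := p) (q := q) hA hB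
  obtain ⟨h2, h3⟩ := two_mul_max_abs_le_of_odd (p := p) (q := q) hA hB
  rw [← eu, ← ev] at h1 h2 h3
  have hu : |2 * x + 1| ≤ 2 * |x| + 1 := by
    have := abs_add_le (2 * x) 1
    rwa [abs_mul, abs_two, abs_one] at this
  have hv : |2 * y + 1| ≤ 2 * |y| + 1 := by
    have := abs_add_le (2 * y) 1
    rwa [abs_mul, abs_two, abs_one] at this
  obtain ⟨M, hM, hw⟩ := wSeq_cases n
  rw [InOctagon, wSeq_add_two]
  rcases h.inOctagon_or with ⟨rfl, rfl⟩ | ⟨g1, g2, g3⟩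
  · simp only [abs_zero] at hu hv
    omega
  · omega

/-! ### Motzkin's construction in a commutative ring -/

theorem representsAllCosets_iff {R : Type*} [CommRing R] {S : Set R} {β : R} :
    RepresentsAllCosets S β ↔ ∀ a, ∃ z, a - β * z ∈ S := by
  constructor
  · intro h a
    obtain ⟨r, hr, e⟩ := h (Ideal.Quotient.mk _ a)
    obtain ⟨z, hz⟩ := Ideal.mem_span_singleton.1 (Ideal.Quotient.eq.1 e.symm)
    exact ⟨z, by rwa [← hz, sub_sub_cancel]⟩
  · intro h c
    obtain ⟨a, rfl⟩ := Ideal.Quotient.mk_surjective c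
    obtain ⟨z, hz⟩ := h a
    refine ⟨_, hz, Ideal.Quotient.eq.2 (Ideal.mem_span_singleton.2 ⟨-z, by ring⟩)⟩

theorem motzkinSet_mono {R : Type*} [CommRing R] : Monotone (motzkinSet R) :=
  monotone_nat_of_le_succ fun _ => Set.subset_union_left

/-- Strong induction on the value: remainders have smaller values, so they already lie in the
preceding set. This yields minimality of `motzkinFunction`. -/
theorem mem_motzkinSet_of_isEuclideanFunction {R : Type*} [CommRing R]
    {f : {a : R // a ≠ 0} → ℕ} (hf : IsEuclideanFunction f) (b : {a : R // a ≠ 0}) :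
    (b : R) ∈ motzkinSet R (f b) := by
  induction hn : f b using Nat.strong_induction_on generalizing b with
  | _ n ih =>
    subst hn
    rcases hb : f b with _ | n
    -- No value is below `0`, so `b` must divide `1`.
    · rcases hf b 1 with h | ⟨r, -, hr⟩
      · exact Or.inr (isUnit_of_dvd_one h)
      · omega
    · refine Or.inr fun c => ?_
      obtain ⟨a, rfl⟩ := Ideal.Quotient.mk_surjective c
      rcases hf b a with h | ⟨r, e, hr⟩
      · refine ⟨0, motzkinSet_mono (Nat.zero_le n) (Or.inl rfl), ?_⟩
        rw [map_zero, eq_comm, Ideal.Quotient.eq_zero_iff_mem]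
        exact Ideal.mem_span_singleton.2 h
      · exact ⟨r, motzkinSet_mono (by omega) (ih _ hr r rfl), e.symm⟩

theorem isLeast_motzkinFunction {R : Type*} [CommRing R]
    (h : ∀ a : R, ∃ n, a ∈ motzkinSet R n) (a : {a : R // a ≠ 0}) :
    IsLeast {n : ℕ | (a : R) ∈ motzkinSet R n} (motzkinFunction R a) :=
  ⟨Nat.sInf_mem (h a), fun _ hn => Nat.sInf_le hn⟩

theorem isMinimalEuclideanFunction_motzkinFunction {R : Type*} [CommRing R]
    (h : ∀ a : R, ∃ n, a ∈ motzkinSet R n) :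
    IsMinimalEuclideanFunction (motzkinFunction R) := by
  refine ⟨fun b a => ?_, fun f hf a =>
    (isLeast_motzkinFunction h a).2 (mem_motzkinSet_of_isEuclideanFunction hf a)⟩
  obtain ⟨hmem, hmin⟩ := isLeast_motzkinFunction h b
  rcases hb : motzkinFunction R b with _ | n
  · rw [hb] at hmem
    exact Or.inl ((hmem.resolve_left b.2).dvd)
  · rw [hb] at hmem hmin
    rcases hmem with hmem | hmem
    · have := hmin hmem
      omega
    · obtain ⟨r, hr, e⟩ := hmem (Ideal.Quotient.mk _ a)
      by_cases hr0 : r = 0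
      · left
        rw [hr0, map_zero, eq_comm, Ideal.Quotient.eq_zero_iff_mem] at e
        exact Ideal.mem_span_singleton.1 e
      · refine Or.inr ⟨⟨r, hr0⟩, e.symm, Nat.lt_succ_of_le ?_⟩
        exact (isLeast_motzkinFunction h ⟨r, hr0⟩).2 hr

/-! ### Digit sets in `ℤ[i]` and Motzkin's recursion -/

theorem mem_digits_iff {z : GaussianInt} :
    z ∈ ({0, 1, -1, gaussI, -gaussI} : Set GaussianInt) ↔ IsDigit z.re z.im := by
  simp only [Set.mem_insert_iff, Set.mem_singleton_iff, Zsqrtd.ext_iff, isDigit_iff, gaussI,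
    Zsqrtd.re_zero, Zsqrtd.im_zero, Zsqrtd.re_one, Zsqrtd.im_one, Zsqrtd.re_neg, Zsqrtd.im_neg]
  omega

theorem mem_digitSet_succ_iff {n : ℕ} {z : GaussianInt} :
    z ∈ digitSet (n + 1) ↔ ∃ d ∈ ({0, 1, -1, gaussI, -gaussI} : Set GaussianInt),
      ∃ w ∈ digitSet n, z = d + (1 + gaussI) * w := by
  constructor
  · rintro ⟨v, hv, rfl⟩
    refine ⟨v 0, hv 0, _, ⟨fun j => v (j + 1), fun j => hv _, rfl⟩, ?_⟩
    rw [Finset.sum_range_succ', Finset.mul_sum, pow_zero, mul_one, add_comm]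
    congr 1
    exact Finset.sum_congr rfl fun j _ => by ring
  · rintro ⟨d, hd, _, ⟨v, hv, rfl⟩, rfl⟩
    refine ⟨fun j => Nat.casesOn j d v, fun j => ?_, ?_⟩
    · cases j
      · exact hd
      · exact hv _
    · rw [Finset.sum_range_succ' _ (n + 1), Finset.mul_sum, pow_zero, mul_one, add_comm]
      congr 1
      exact Finset.sum_congr rfl fun j _ => by ring

theorem mem_digitSet_iff {n : ℕ} {z : GaussianInt} :
    z ∈ digitSet n ↔ InDyadicOctagon n z.re z.im := by
  induction n generalizing z with
  | zero =>
    rw [inDyadicOctagon_zero_iff, ← mem_digits_iff]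
    constructor
    · rintro ⟨v, hv, rfl⟩
      simpa using hv 0
    · intro h
      exact ⟨fun _ => z, fun _ => h, by simp⟩
  | succ n ih =>
    rw [mem_digitSet_succ_iff, inDyadicOctagon_succ_iff]
    constructor
    · rintro ⟨d, hd, w, hw, rfl⟩
      exact ⟨d.re, d.im, w.re, w.im, mem_digits_iff.1 hd, ih.1 hw, by simp [gaussI]; ring,
        by simp [gaussI]; ring⟩
    · rintro ⟨e, f, u, v, hd, h, hx, hy⟩
      refine ⟨⟨e, f⟩, mem_digits_iff.2 hd, ⟨u, v⟩, ih.2 h, ?_⟩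
      rw [Zsqrtd.ext_iff, hx, hy]
      constructor <;> simp [gaussI] <;> ring

theorem representsAllCosets_digitSet_iff {n : ℕ} {β : GaussianInt} :
    RepresentsAllCosets (digitSet n) β ↔
      ∀ x y, HasDyadicRepresentative n β.re β.im x y := by
  rw [representsAllCosets_iff]
  constructor
  · intro h x y
    obtain ⟨z, hz⟩ := h ⟨x, y⟩
    refine ⟨z.re, z.im, ?_⟩
    rw [mem_digitSet_iff] at hz
    convert hz using 1 <;> simp [sub_eq_add_neg]
  · intro h a
    obtain ⟨s, t, h⟩ := h a.re a.im
    refine ⟨⟨s, t⟩, mem_digitSet_iff.2 ?_⟩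
    convert h using 1 <;> simp [sub_eq_add_neg]

theorem exists_eq_one_add_gaussI_mul {z : GaussianInt} (h : Even (z.re + z.im)) :
    ∃ w, z = (1 + gaussI) * w := by
  obtain ⟨c, hc⟩ := h
  refine ⟨⟨c, c - z.re⟩, ?_⟩
  rw [Zsqrtd.ext_iff]
  constructor <;> simp [gaussI]
  linarith

theorem one_add_gaussI_mul_mem_digitSet_iff {n : ℕ} {w : GaussianInt} :
    (1 + gaussI) * w ∈ digitSet (n + 1) ↔ w ∈ digitSet n := by
  have hre : ((1 + gaussI) * w).re = w.re - w.im := by simp [gaussI, sub_eq_add_neg]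
  have him : ((1 + gaussI) * w).im = w.re + w.im := by simp [gaussI, add_comm]
  rw [mem_digitSet_iff, mem_digitSet_iff, hre, him, inDyadicOctagon_mul_one_add_I_iff]

theorem exists_eq_digit_add_mul (a : GaussianInt) :
    ∃ d ∈ ({0, 1, -1, gaussI, -gaussI} : Set GaussianInt), ∃ w, a = d + (1 + gaussI) * w := by
  rcases Int.even_or_odd (a.re + a.im) with h | h
  · obtain ⟨w, hw⟩ := exists_eq_one_add_gaussI_mul h
    exact ⟨0, by simp, w, by rw [zero_add, hw]⟩
  · obtain ⟨w, hw⟩ := exists_eq_one_add_gaussI_mul (z := a - 1) (by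
      obtain ⟨c, hc⟩ := h
      exact ⟨c, by simp; omega⟩)
    exact ⟨1, by simp, w, by rw [← hw]; ring⟩

/-- Downwards, the coset of `(1+i) a` consists of multiples of `1+i`, and that factor cancels.
Upwards, write `a = d + (1+i) w` with a digit `d` and represent `w` modulo `γ`. -/
theorem representsAllCosets_one_add_gaussI_mul_iff {n : ℕ} {γ : GaussianInt} :
    RepresentsAllCosets (digitSet (n + 1)) ((1 + gaussI) * γ) ↔
      RepresentsAllCosets (digitSet n) γ := by
  rw [representsAllCosets_iff, representsAllCosets_iff]
  constructor
  · intro h a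
    obtain ⟨z, hz⟩ := h ((1 + gaussI) * a)
    refine ⟨z, one_add_gaussI_mul_mem_digitSet_iff.1 ?_⟩
    convert hz using 1
    ring
  · intro h a
    obtain ⟨d, hd, w, rfl⟩ := exists_eq_digit_add_mul a
    obtain ⟨z, hz⟩ := h w
    exact ⟨z, mem_digitSet_succ_iff.2 ⟨d, hd, _, hz, by ring⟩⟩

theorem mem_digitSet_zero_iff {z : GaussianInt} : z ∈ digitSet 0 ↔ z = 0 ∨ IsUnit z := by
  rw [mem_digitSet_iff, inDyadicOctagon_zero_iff]
  constructor
  · intro h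
    have h := mem_digits_iff.2 h
    simp only [Set.mem_insert_iff, Set.mem_singleton_iff] at h
    have hI : IsUnit gaussI := IsUnit.of_mul_eq_one (-gaussI) (by
      simp [Zsqrtd.ext_iff, gaussI])
    rcases h with rfl | rfl | rfl | rfl | rfl
    · exact Or.inl rfl
    · exact Or.inr isUnit_one
    · exact Or.inr isUnit_one.neg
    · exact Or.inr hI
    · exact Or.inr hI.neg
  · rintro (rfl | h)
    · simp [IsDigit]
    · have h := (Zsqrtd.norm_eq_one_iff' (by norm_num) z).2 h
      rw [Zsqrtd.norm_def] at h
      rw [isDigit_iff]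
      refine ⟨?_, ?_, ?_, ?_⟩ <;> nlinarith [sq_nonneg (z.re + z.im), sq_nonneg (z.re - z.im)]

theorem mem_digitSet_zero_iff_representsAllCosets {γ : GaussianInt} (h0 : γ ≠ 0) :
    γ ∈ digitSet 0 ↔ RepresentsAllCosets (digitSet 0) ((1 + gaussI) * γ) := by
  rw [mem_digitSet_zero_iff, representsAllCosets_iff]
  constructor
  · intro h a
    obtain ⟨u, hu⟩ := h.resolve_left h0 |>.exists_right_inv
    obtain ⟨d, hd, w, rfl⟩ := exists_eq_digit_add_mul a
    refine ⟨u * w, ?_⟩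
    rw [show d + (1 + gaussI) * w - (1 + gaussI) * γ * (u * w) =
      d + (1 + gaussI) * w * (1 - γ * u) by ring, hu, sub_self, mul_zero, add_zero]
    exact mem_digitSet_iff.2 (inDyadicOctagon_zero_iff.2 (mem_digits_iff.1 hd))
  · intro h
    -- The coset of `1+i` contains only multiples of `1+i`, and the only digit among these is `0`;
    -- this gives `γ z = 1`.
    obtain ⟨z, hz⟩ := h (1 + gaussI)
    rw [show (1 + gaussI) - (1 + gaussI) * γ * z = (1 + gaussI) * (1 - γ * z) by ring] at hz
    generalize hw : 1 - γ * z = w at hz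
    have : w = 0 := by
      rw [mem_digitSet_iff, inDyadicOctagon_zero_iff, isDigit_iff] at hz
      simp [gaussI] at hz
      rw [Zsqrtd.ext_iff, Zsqrtd.re_zero, Zsqrtd.im_zero]
      omega
    rw [this, sub_eq_zero] at hw
    exact Or.inr (IsUnit.of_mul_eq_one z hw.symm)

/-- The digit sets obey Motzkin's recursion. -/
theorem mem_digitSet_succ_iff_representsAllCosets {n : ℕ} {β : GaussianInt} (h0 : β ≠ 0) :
    β ∈ digitSet (n + 1) ↔ RepresentsAllCosets (digitSet n) β := by
  rcases Int.even_or_odd (β.re + β.im) with he | ho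
  swap
  · rw [mem_digitSet_iff, inDyadicOctagon_iff_of_primitive (by rw [Int.odd_iff] at ho; omega),
      representsAllCosets_digitSet_iff]
    exact ⟨hasDyadicRepresentative_of_odd ho, inOctagon_of_forall_hasDyadicRepresentative ho⟩
  obtain ⟨γ, rfl⟩ := exists_eq_one_add_gaussI_mul he
  have hγ : γ ≠ 0 := right_ne_zero_of_mul h0
  rw [one_add_gaussI_mul_mem_digitSet_iff]
  -- At `n = 0` there is no lower digit set to descend to, so this case is settled directly;
  -- otherwise the recursion continues with `γ` one level down.
  cases n with
  | zero => exact mem_digitSet_zero_iff_representsAllCosets hγ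
  | succ n =>
    rw [representsAllCosets_one_add_gaussI_mul_iff]
    exact mem_digitSet_succ_iff_representsAllCosets hγ

theorem digitSet_subset_succ (n : ℕ) : digitSet n ⊆ digitSet (n + 1) := fun _ h =>
  mem_digitSet_iff.2 (mem_digitSet_iff.1 h).succ

theorem motzkinSet_gaussianInt (n : ℕ) : motzkinSet GaussianInt n = digitSet n := by
  induction n with
  | zero =>
    ext z
    rw [mem_digitSet_zero_iff]
    rfl
  | succ n ih =>
    ext β
    rw [motzkinSet, ih]
    by_cases h0 : β = 0
    · have : ∀ m, β ∈ digitSet m := fun m => by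
        rw [mem_digitSet_iff, h0]
        exact inDyadicOctagon_zero m
      exact iff_of_true (Or.inl (this n)) (this _)
    · constructor
      · rintro (h | h)
        · exact digitSet_subset_succ n h
        · exact (mem_digitSet_succ_iff_representsAllCosets h0).2 h
      · exact fun h => Or.inr ((mem_digitSet_succ_iff_representsAllCosets h0).1 h)

/-! ### Exhaustion of `ℤ[i]` and the explicit description -/

theorem exists_inOctagon (x y : ℤ) : ∃ k, InOctagon k x y := by
  refine ⟨2 * (x.natAbs + y.natAbs), ?_⟩
  have h : ((x.natAbs + y.natAbs : ℕ) : ℤ) < 2 ^ (x.natAbs + y.natAbs) := by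
    exact_mod_cast Nat.lt_two_pow_self
  have h1 : (1 : ℤ) ≤ 2 ^ (x.natAbs + y.natAbs) := one_le_pow₀ (by norm_num)
  rw [inOctagon_iff, wSeq_two_mul, wSeq_two_mul_add_one]
  omega

theorem exists_mem_digitSet (z : GaussianInt) : ∃ n, z ∈ digitSet n := by
  by_cases h0 : z.re = 0 ∧ z.im = 0
  · exact ⟨0, mem_digitSet_iff.2 (Or.inl h0)⟩
  · obtain ⟨j, x, y, hx, hy, hp⟩ := exists_eq_two_pow_mul_primitive h0
    obtain ⟨k, hk⟩ := exists_inOctagon x y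
    exact ⟨2 * j + k, mem_digitSet_iff.2 (Or.inr ⟨j, k, x, y, rfl, hx, hy, hp, hk⟩)⟩

theorem exactlyDividesGcd_iff {j : ℕ} {x y : ℤ} : ExactlyDividesGcd j x y ↔
    ∃ x' y', x = 2 ^ j * x' ∧ y = 2 ^ j * y' ∧ ¬ (2 ∣ x' ∧ 2 ∣ y') := by
  have h : ∀ i : ℕ, 2 ^ i ∣ Int.gcd x y ↔ (2 : ℤ) ^ i ∣ x ∧ (2 : ℤ) ^ i ∣ y := fun i => by
    rw [Int.gcd_eq_natAbs, Nat.dvd_gcd_iff, ← Int.natCast_dvd, ← Int.natCast_dvd]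
    push_cast
    rfl
  have h2 : (2 : ℤ) ^ j ≠ 0 := by positivity
  rw [ExactlyDividesGcd, h, h]
  constructor
  · rintro ⟨⟨⟨x', rfl⟩, ⟨y', rfl⟩⟩, hn⟩
    refine ⟨x', y', rfl, rfl, ?_⟩
    rwa [pow_succ, mul_dvd_mul_iff_left h2, mul_dvd_mul_iff_left h2] at hn
  · rintro ⟨x', y', rfl, rfl, hn⟩
    refine ⟨⟨dvd_mul_right _ _, dvd_mul_right _ _⟩, ?_⟩
    rwa [pow_succ, mul_dvd_mul_iff_left h2, mul_dvd_mul_iff_left h2]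

theorem inOctagon_iff_two_pow_mul {j k : ℕ} {x y : ℤ} : InOctagon k x y ↔
    |2 ^ j * x| ≤ wSeq (2 * j + k) - 2 ^ (j + 1) ∧ |2 ^ j * y| ≤ wSeq (2 * j + k) - 2 ^ (j + 1) ∧
      |2 ^ j * x| + |2 ^ j * y| ≤ wSeq (2 * j + k + 1) - 3 * 2 ^ j := by
  have h2 : (0 : ℤ) < 2 ^ j := by positivity
  rw [InOctagon, add_assoc, wSeq_two_mul_add, wSeq_two_mul_add, abs_mul, abs_mul, abs_of_pos h2,
    pow_succ, ← mul_sub, mul_comm 3, ← mul_sub, ← mul_add, mul_le_mul_iff_right₀ h2,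
    mul_le_mul_iff_right₀ h2, mul_le_mul_iff_right₀ h2]

theorem digitSet_diff_zero (n : ℕ) : digitSet n \ {0} =
    ⋃ (j : ℕ) (_ : j ≤ n / 2),
      {z : GaussianInt | ExactlyDividesGcd j z.re z.im ∧
        |z.re| ≤ wSeq n - 2 ^ (j + 1) ∧ |z.im| ≤ wSeq n - 2 ^ (j + 1) ∧
        |z.re| + |z.im| ≤ wSeq (n + 1) - 3 * 2 ^ j} := by
  ext z
  simp only [Set.mem_sdiff, Set.mem_singleton_iff, Set.mem_iUnion, Set.mem_ofPred_eq,
    exists_prop, mem_digitSet_iff, exactlyDividesGcd_iff]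
  constructor
  · rintro ⟨⟨hx, hy⟩ | ⟨j, k, x, y, rfl, hx, hy, hp, hO⟩, h0⟩
    · exact absurd (Zsqrtd.ext hx hy) h0
    · refine ⟨j, by omega, ⟨x, y, hx, hy, hp⟩, ?_⟩
      rw [hx, hy]
      exact inOctagon_iff_two_pow_mul.1 hO
  · rintro ⟨j, hj, ⟨x, y, hx, hy, hp⟩, hO⟩
    obtain ⟨k, rfl⟩ := Nat.exists_eq_add_of_le (show 2 * j ≤ n by omega)
    rw [hx, hy] at hO
    refine ⟨Or.inr ⟨j, k, x, y, rfl, hx, hy, hp, inOctagon_iff_two_pow_mul.2 hO⟩, ?_⟩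
    rintro rfl
    have h2 : (2 : ℤ) ^ j ≠ 0 := by positivity
    simp only [Zsqrtd.re_zero, Zsqrtd.im_zero, zero_eq_mul, h2, false_or] at hx hy
    exact hp ⟨by simp [hx], by simp [hy]⟩

theorem mainTheorem1 :
    (∀ n : ℕ, motzkinSet GaussianInt n = digitSet n) ∧
    (IsMinimalEuclideanFunction (motzkinFunction GaussianInt) ∧
      ∀ z : {z : GaussianInt // z ≠ 0},
        IsLeast {n : ℕ | (z : GaussianInt) ∈ digitSet n} (motzkinFunction GaussianInt z)) ∧
    (∀ n : ℕ, digitSet n \ {0} =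
      ⋃ (j : ℕ) (_ : j ≤ n / 2),
        {z : GaussianInt | ExactlyDividesGcd j z.re z.im ∧
          |z.re| ≤ wSeq n - 2 ^ (j + 1) ∧ |z.im| ≤ wSeq n - 2 ^ (j + 1) ∧
          |z.re| + |z.im| ≤ wSeq (n + 1) - 3 * 2 ^ j}) := by
  have hex : ∀ a : GaussianInt, ∃ n, a ∈ motzkinSet GaussianInt n := fun a => by
    simpa only [motzkinSet_gaussianInt] using exists_mem_digitSet a
  refine ⟨motzkinSet_gaussianInt, ⟨isMinimalEuclideanFunction_motzkinFunction hex, fun z => ?_⟩,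
    digitSet_diff_zero⟩
  simpa only [motzkinSet_gaussianInt] using isLeast_motzkinFunction hex z
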